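/- **Setting.** Let $\mathcal X=\{x\in\mathbb R^d: Ax\le b\}$ be a bounded polytope (finitely many constraints) with vertex set $\mathcal V$ and Euclidean diameter $D$. Let $f:\mathbb R^d\to\mathbb R$ be differentiable at every point of $\mathcal X$, with $L>0$ and $\mu>0$ such that, for all $x,y\in\mathcal X$, $\|\nabla f(x)-\nabla f(y)\|\le L\|x-y\|$ and $f(y)\ge f(x)+\nabla f(x)^T(y-x)+\frac{\mu}{2}\|x-y\|^2$. Write $f^*=\min_{\mathcal X}f$. Fix $\varepsilon>0$ and $\varepsilon_g>0$ with $4D\varepsilon_g<1$ (that is, $\varepsilon_g\in(0,1/(4D))$ if $D>0$). For random iterates $X_0,X_1,\dots$ put $T_\varepsilon=\inf\{k\ge 0: f(X_k)-f^*\le\varepsilon\}\in\{0,1,2,\dots\}\cup\{\infty\}$. Both algorithms below use random gradient estimates $G_k$ of $\nabla f(X_k)$, and in iteration $k$ they take a vertex $S_k\in\mathcal V$ that minimizes $s\mapsto G_k^Ts$ over $\mathcal X$. They run up to time $T_\varepsilon$, after which all quantities stay constant. *Standard Frank–Wolfe* ($q=S$). Start from $X_0\in\mathcal X$. For $k<T_\varepsilon$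 set $X_{k+1}=X_k+\min\{1,\frac{\varepsilon}{2LD^2}\}(S_k-X_k)$. Let $\mathcal F_k$ be the $\sigma$-algebra generated by $(G_i,S_i)_{i<k}$ and $(X_i)_{i\le k}$, let $E^{(S)}_k=\{\|G_k-\nabla f(X_k)\|\le\frac{\varepsilon}{4D}\}$, and let $\Phi^{(S)}_k=\exp(f(X_k)-f^*)$. *Away-step Frank–Wolfe* ($q=A$). The iterate is kept as a convex combination $X_k=\sum_{v\in\mathcal V}\alpha^{(k)}_v v$, with active set $\mathcal U_k=\{v:\alpha^{(k)}_v>0\}$ and $N_k=|\mathcal U_k|$; the initial representation is arbitrary. For $k<T_\varepsilon$ let $V_k$ maximize $u\mapsto G_k^Tu$ over $\mathcal U_k$. - If $-G_k^T(S_k-X_k)\ge -G_k^T(X_k-V_k)$, set $d_k=S_k-X_k$, $\gamma_k^{\max}=1$ and $\gamma_k=\min\{\gamma_k^{\max},\frac{-G_k^Td_k}{L\|d_k\|^2}\}$. All weights are multiplied by $1-\gamma_k$, and then $\gamma_k$ is added to the weight of $S_k$. - Otherwise set $d_k=X_k-V_k$, $\gamma_k^{\max}=\alpha^{(k)}_{V_k}/(1-\alpha^{(k)}_{V_k})$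 and $\gamma_k=\min\{\gamma_k^{\max},\frac{-G_k^Td_k}{L\|d_k\|^2}\}$. All weights are multiplied by $1+\gamma_k$, and then $\gamma_k$ is subtracted from the weight of $V_k$. In both cases $X_{k+1}=X_k+\gamma_kd_k$ (if $d_k=0$, the iterate does not move; the quotient is then read as $0$). Let $\mathcal F_k$ be the $\sigma$-algebra generated by $(G_i,S_i,V_i,\mathcal U_i)_{i<k}$ and $(X_i)_{i\le k}$, let $E^{(A)}_k=\{\|G_k-\nabla f(X_k)\|\le\varepsilon_g\,G_k^T(V_k-S_k)\}$, and, for $\nu\in(0,1)$, let $\Phi^{(A)}_k=\exp\big(\nu(f(X_k)-f^*)+(1-\nu)N_k\big)$. **Theorem.** There exist $p_g,\nu,\delta_S,\delta_A\in(0,1)$, depending only on the deterministic data $A,b,f,L,\mu,\varepsilon,\varepsilon_g$, such that for $q=S$ and $q=A$, for every process generated by the corresponding algorithm on any probability space and every $k\ge0$: if $\mathbb P(E^{(q)}_k\mid\mathcal F_k)\ge p_g$ almost surely on $\{k<T_\varepsilon\}$, then $\Phi^{(q)}_{k+1}/\Phi^{(q)}_k$ is integrable and, almost surely, $$I(T_\varepsilon>k)\;\mathbb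 E\!\left[\frac{\Phi^{(q)}_{k+1}}{\Phi^{(q)}_k}\,\Big|\,\mathcal F_k\right]\le e^{-\delta_q}.$$ -/

import Mathlib

open MeasureTheory ProbabilityTheory

noncomputable section

namespace FrankWolfe

/-- The polyhedron `{x ∈ ℝ^d : A x ≤ b}`, with the Euclidean norm on `ℝ^d`. -/
def feasible {d m : ℕ} (A : Matrix (Fin m) (Fin d) ℝ) (b : Fin m → ℝ) :
    Set (EuclideanSpace ℝ (Fin d)) :=
  {x | ∀ i, A.mulVec x.ofLp i ≤ b i}

section Runs

variable {d : ℕ} {Ω : Type*}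

/-- The optimal value `f* = inf {f x : x ∈ K}` (a minimum when `K` is a nonempty polytope and
`f` is continuous on it). -/
def optVal (K : Set (EuclideanSpace ℝ (Fin d))) (f : EuclideanSpace ℝ (Fin d) → ℝ) : ℝ :=
  sInf (f '' K)

/-- The terminal time `T_ε = inf {k ≥ 0 : f (X_k) - f* ≤ ε}`, with value `⊤` if there is no
such `k`. -/
def terminalTime (K : Set (EuclideanSpace ℝ (Fin d))) (f : EuclideanSpace ℝ (Fin d) → ℝ)
    (ε : ℝ) (X : ℕ → Ω → EuclideanSpace ℝ (Fin d)) (ω : Ω) : ℕ∞ :=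
  sInf {t : ℕ∞ | ∃ k : ℕ, t = (k : ℕ∞) ∧ f (X k ω) - optVal K f ≤ ε}

/-- `s` is a vertex of `K` solving the linear program `min {gᵀy : y ∈ K}`. -/
def IsVertexSolution (K : Set (EuclideanSpace ℝ (Fin d))) (g s : EuclideanSpace ℝ (Fin d)) :
    Prop :=
  s ∈ K.extremePoints ℝ ∧ ∀ y ∈ K, inner ℝ g s ≤ inner ℝ g y

/-! ### Standard Frank-Wolfe -/

/-- The random process `(X_k, G_k, S_k)` generated by the standard Frank-Wolfe algorithm on `K`
with arbitrary random gradient estimates `G_k`. The algorithm runs up to the terminal time, and all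
quantities are constant afterwards. -/
structure StandardRun (K : Set (EuclideanSpace ℝ (Fin d)))
    (f : EuclideanSpace ℝ (Fin d) → ℝ) (L ε : ℝ) (Ω : Type*) [MeasurableSpace Ω] where
  /-- iterates -/
  X : ℕ → Ω → EuclideanSpace ℝ (Fin d)
  /-- gradient estimates -/
  G : ℕ → Ω → EuclideanSpace ℝ (Fin d)
  /-- vertices returned by the linear program -/
  S : ℕ → Ω → EuclideanSpace ℝ (Fin d)
  measurable_X : ∀ k, Measurable (X k)
  measurable_G : ∀ k, Measurable (G k)
  measurable_S : ∀ k, Measurable (S k)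
  init : ∀ ω, X 0 ω ∈ K
  lp : ∀ (k : ℕ) ω, (k : ℕ∞) < terminalTime K f ε X ω → IsVertexSolution K (G k ω) (S k ω)
  step : ∀ (k : ℕ) ω, (k : ℕ∞) < terminalTime K f ε X ω →
    X (k + 1) ω = X k ω + min 1 (ε / (2 * L * Metric.diam K ^ 2)) • (S k ω - X k ω)
  stopped : ∀ (k : ℕ) ω, terminalTime K f ε X ω ≤ (k : ℕ∞) →
    X (k + 1) ω = X k ω ∧ G (k + 1) ω = G k ω ∧ S (k + 1) ω = S k ω

namespace StandardRun

variable [MeasurableSpace Ω] {K : Set (EuclideanSpace ℝ (Fin d))}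
  {f : EuclideanSpace ℝ (Fin d) → ℝ} {L ε : ℝ}

/-- The terminal time of the run. -/
def T (R : StandardRun K f L ε Ω) : Ω → ℕ∞ := terminalTime K f ε R.X

/-- `ℱ_k`, generated by `(G_i, S_i)` for `i < k` and `X_i` for `i ≤ k`. -/
def filtration (R : StandardRun K f L ε Ω) : Filtration ℕ ‹MeasurableSpace Ω› where
  seq k := (⨆ i < k, (MeasurableSpace.comap (R.G i) inferInstance ⊔
      MeasurableSpace.comap (R.S i) inferInstance)) ⊔
    ⨆ i ≤ k, MeasurableSpace.comap (R.X i) inferInstance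
  mono' := fun _ _ hjk => sup_le_sup
    (iSup₂_le fun i hi => le_iSup₂_of_le i (hi.trans_le hjk) le_rfl)
    (iSup₂_le fun i hi => le_iSup₂_of_le i (hi.trans hjk) le_rfl)
  le' := fun _ => sup_le
    (iSup₂_le fun i _ => sup_le (R.measurable_G i).comap_le (R.measurable_S i).comap_le)
    (iSup₂_le fun i _ => (R.measurable_X i).comap_le)

/-- The event that `G_k` is a good gradient estimate: `‖G_k - ∇f(X_k)‖ ≤ ε / (4 D)`. -/
def goodEvent (R : StandardRun K f L ε Ω) (k : ℕ) : Set Ω :=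
  {ω | ‖R.G k ω - gradient f (R.X k ω)‖ ≤ ε / (4 * Metric.diam K)}

/-- At iteration `k`, `G_k` is a good gradient estimate with (conditional) probability at least
`p`, on the event `{k < T_ε}`. -/
def GoodWithProb (R : StandardRun K f L ε Ω) (P : Measure Ω) (p : ℝ) (k : ℕ) : Prop :=
  ∀ᵐ ω ∂P, (k : ℕ∞) < R.T ω → p ≤ (P⟦R.goodEvent k|R.filtration k⟧) ω

/-- The process `Φ_k = exp (f (X_k) - f*)`. -/
def Φ (R : StandardRun K f L ε Ω) (k : ℕ) (ω : Ω) : ℝ :=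
  Real.exp (f (R.X k ω) - optVal K f)

end StandardRun

/-! ### Away-step Frank-Wolfe -/

/-- One iteration of the away-step algorithm, from the iterate `x` with vertex weights `α`, the
gradient estimate `g`, the vertex `s` of the linear program and the worst active vertex `v`: the
next iterate and the next weights. If `d = 0` the quotient in the step size is read as `0`, and
the iterate does not move. -/
def awayStep (L : ℝ) (x g s v : EuclideanSpace ℝ (Fin d)) (α : EuclideanSpace ℝ (Fin d) →₀ ℝ) :
    EuclideanSpace ℝ (Fin d) × (EuclideanSpace ℝ (Fin d) →₀ ℝ) :=
  if -inner ℝ g (s - x) ≥ -inner ℝ g (x - v) then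
    let γ : ℝ := min 1 (-inner ℝ g (s - x) / (L * ‖s - x‖ ^ 2))
    (x + γ • (s - x), (1 - γ) • α + Finsupp.single s γ)
  else
    let γ : ℝ := min (α v / (1 - α v)) (-inner ℝ g (x - v) / (L * ‖x - v‖ ^ 2))
    (x + γ • (x - v), (1 + γ) • α - Finsupp.single v γ)

/-- The random process generated by the away-step Frank-Wolfe algorithm on `K` with arbitrary
random gradient estimates `G_k`. The weights `α_k` represent `X_k` as a convex combination of
vertices; the active set `U_k` is the set of vertices with nonzero (that is, positive) weight. The
algorithm runs up to the terminal time, and all quantities are constant afterwards. -/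
structure AwayRun (K : Set (EuclideanSpace ℝ (Fin d)))
    (f : EuclideanSpace ℝ (Fin d) → ℝ) (L ε : ℝ) (Ω : Type*) [MeasurableSpace Ω] where
  /-- iterates -/
  X : ℕ → Ω → EuclideanSpace ℝ (Fin d)
  /-- gradient estimates -/
  G : ℕ → Ω → EuclideanSpace ℝ (Fin d)
  /-- vertices returned by the linear program -/
  S : ℕ → Ω → EuclideanSpace ℝ (Fin d)
  /-- candidate active vertices for the away step -/
  V : ℕ → Ω → EuclideanSpace ℝ (Fin d)
  /-- weights of the vertex representation -/
  α : ℕ → Ω → EuclideanSpace ℝ (Fin d) →₀ ℝ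
  measurable_X : ∀ k, Measurable (X k)
  measurable_G : ∀ k, Measurable (G k)
  measurable_S : ∀ k, Measurable (S k)
  measurable_V : ∀ k, Measurable (V k)
  measurable_α : ∀ k v, Measurable fun ω => α k ω v
  init_vertices : ∀ ω, ∀ v ∈ (α 0 ω).support, v ∈ K.extremePoints ℝ
  init_nonneg : ∀ ω v, 0 ≤ α 0 ω v
  init_sum : ∀ ω, ((α 0 ω).sum fun _ a => a) = 1
  init : ∀ ω, X 0 ω = (α 0 ω).sum fun v a => a • v
  lp : ∀ (k : ℕ) ω, (k : ℕ∞) < terminalTime K f ε X ω → IsVertexSolution K (G k ω) (S k ω)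
  away : ∀ (k : ℕ) ω, (k : ℕ∞) < terminalTime K f ε X ω →
    V k ω ∈ (α k ω).support ∧
      ∀ u ∈ (α k ω).support, inner ℝ (G k ω) u ≤ inner ℝ (G k ω) (V k ω)
  step : ∀ (k : ℕ) ω, (k : ℕ∞) < terminalTime K f ε X ω →
    (X (k + 1) ω, α (k + 1) ω) = awayStep L (X k ω) (G k ω) (S k ω) (V k ω) (α k ω)
  stopped : ∀ (k : ℕ) ω, terminalTime K f ε X ω ≤ (k : ℕ∞) →
    X (k + 1) ω = X k ω ∧ G (k + 1) ω = G k ω ∧ S (k + 1) ω = S k ω ∧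
      V (k + 1) ω = V k ω ∧ α (k + 1) ω = α k ω

namespace AwayRun

variable [MeasurableSpace Ω] {K : Set (EuclideanSpace ℝ (Fin d))}
  {f : EuclideanSpace ℝ (Fin d) → ℝ} {L ε : ℝ}

/-- The terminal time of the run. -/
def T (R : AwayRun K f L ε Ω) : Ω → ℕ∞ := terminalTime K f ε R.X

/-- The active set `U_k`. -/
def U (R : AwayRun K f L ε Ω) (k : ℕ) (ω : Ω) : Finset (EuclideanSpace ℝ (Fin d)) :=
  (R.α k ω).support

/-- The σ-algebra generated by the active set `U_k`, a random subset of the finite set of vertices: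
it is generated by the events `{v ∈ U_k}`. -/
abbrev sigmaU (R : AwayRun K f L ε Ω) (k : ℕ) : MeasurableSpace Ω :=
  MeasurableSpace.generateFrom
    (Set.range fun v : EuclideanSpace ℝ (Fin d) => {ω | v ∈ R.U k ω})

theorem sigmaU_le (R : AwayRun K f L ε Ω) (k : ℕ) : R.sigmaU k ≤ ‹MeasurableSpace Ω› := by
  refine MeasurableSpace.generateFrom_le ?_
  rintro _ ⟨v, rfl⟩
  have h : {ω | v ∈ R.U k ω} = (fun ω => R.α k ω v) ⁻¹' {0}ᶜ := by
    ext ω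
    simp [U]
  change MeasurableSet {ω | v ∈ R.U k ω}
  rw [h]
  exact R.measurable_α k v (measurableSet_singleton 0).compl

/-- `ℱ_k`, generated by `(G_i, S_i, V_i, U_i)` for `i < k` and `X_i` for `i ≤ k`. -/
def filtration (R : AwayRun K f L ε Ω) : Filtration ℕ ‹MeasurableSpace Ω› where
  seq k := (⨆ i < k, (MeasurableSpace.comap (R.G i) inferInstance ⊔
      MeasurableSpace.comap (R.S i) inferInstance ⊔
      MeasurableSpace.comap (R.V i) inferInstance ⊔ R.sigmaU i)) ⊔
    ⨆ i ≤ k, MeasurableSpace.comap (R.X i) inferInstance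
  mono' := fun _ _ hjk => sup_le_sup
    (iSup₂_le fun i hi => le_iSup₂_of_le i (hi.trans_le hjk) le_rfl)
    (iSup₂_le fun i hi => le_iSup₂_of_le i (hi.trans hjk) le_rfl)
  le' := fun _ => sup_le
    (iSup₂_le fun i _ => sup_le (sup_le (sup_le (R.measurable_G i).comap_le
      (R.measurable_S i).comap_le) (R.measurable_V i).comap_le) (R.sigmaU_le i))
    (iSup₂_le fun i _ => (R.measurable_X i).comap_le)

/-- The event that `G_k` is a good gradient estimate:
`‖G_k - ∇f(X_k)‖ ≤ ε_g G_kᵀ(V_k - S_k)`. -/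
def goodEvent (R : AwayRun K f L ε Ω) (εg : ℝ) (k : ℕ) : Set Ω :=
  {ω | ‖R.G k ω - gradient f (R.X k ω)‖ ≤ εg * inner ℝ (R.G k ω) (R.V k ω - R.S k ω)}

/-- At iteration `k`, `G_k` is a good gradient estimate with (conditional) probability at least
`p`, on the event `{k < T_ε}`. -/
def GoodWithProb (R : AwayRun K f L ε Ω) (P : Measure Ω) (εg p : ℝ) (k : ℕ) : Prop :=
  ∀ᵐ ω ∂P, (k : ℕ∞) < R.T ω → p ≤ (P⟦R.goodEvent εg k|R.filtration k⟧) ω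

/-- The process `Φ_k = exp (ν (f (X_k) - f*) + (1 - ν) N_k)`, where `N_k` is the number of active
vertices. -/
def Φ (R : AwayRun K f L ε Ω) (ν : ℝ) (k : ℕ) (ω : Ω) : ℝ :=
  Real.exp (ν * (f (R.X k ω) - optVal K f) + (1 - ν) * ((R.U k ω).card : ℝ))

end AwayRun

end Runs

end FrankWolfe

end

namespace FrankWolfe

/-! The ratio `Φ (k + 1) / Φ k` is the exponential of a one-step change. Two facts about that change
suffice: it is bounded above by a constant for every gradient estimate, and it is at most `-κ` with
`κ > 0` when the estimate is good and `k < T`. A conditional probability close enough to 1 then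
outweighs the bad steps (`condExp_le_of_prob_le`, `exists_prob_threshold`).

The bound for arbitrary estimates comes from compactness (`f` oscillates by at most `M` on the
polytope) and from the fact that a step activates at most one new vertex.

For good estimates, convexity turns `f x - f* > ε` into a Frank–Wolfe gap of at least `ε`. In the
standard method the fixed step then lowers `f` by a fixed amount (`standardStep_progress`). In the
away-step method, either `f` drops by at least a fixed `c` while the active set gains at most one
vertex, or the step is truncated, so that `f` does not increase and a vertex is dropped
(`IsVertexRepr.next_progress`). Choosing `ν * c = 2 * (1 - ν)` makes the exponent drop by at least
`1 - ν` in both cases. -/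

/-! ### Geometry of the polyhedron: convexity, closedness, finitely many vertices. -/

theorem convex_feasible {d m : ℕ} (A : Matrix (Fin m) (Fin d) ℝ) (b : Fin m → ℝ) :
    Convex ℝ (feasible A b) := by
  intro x hx y hy s t hs ht hst i
  have h1 := mul_le_mul_of_nonneg_left (hx i) hs
  have h2 := mul_le_mul_of_nonneg_left (hy i) ht
  have h3 : b i = s * b i + t * b i := by rw [← add_mul, hst, one_mul]
  simp only [WithLp.ofLp_add, WithLp.ofLp_smul, Matrix.mulVec_add, Matrix.mulVec_smul,
    Pi.add_apply, Pi.smul_apply, smul_eq_mul]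
  linarith

theorem continuous_mulVec_apply {d m : ℕ} (A : Matrix (Fin m) (Fin d) ℝ) (i : Fin m) :
    Continuous fun x : EuclideanSpace ℝ (Fin d) => A.mulVec x.ofLp i := by
  simp only [Matrix.mulVec, dotProduct]
  fun_prop

theorem isClosed_feasible {d m : ℕ} (A : Matrix (Fin m) (Fin d) ℝ) (b : Fin m → ℝ) :
    IsClosed (feasible A b) := by
  simp only [feasible, Set.ofPred_forall]
  exact isClosed_iInter fun i => isClosed_le (continuous_mulVec_apply A i) continuous_const

/-- An extreme point of a polyhedron is determined by its set of active constraints. -/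
theorem eq_of_active_eq {d m : ℕ} {A : Matrix (Fin m) (Fin d) ℝ} {b : Fin m → ℝ}
    {x y : EuclideanSpace ℝ (Fin d)} (hx : x ∈ (feasible A b).extremePoints ℝ)
    (hxy : ∀ i, A.mulVec x.ofLp i = b i → A.mulVec y.ofLp i = b i) : x = y := by
  -- Constraints active at `x` are constant along the line to `y`, and the others are strict at `x`.
  -- So `x` can move a little both ways along this line, which extremality forbids unless `y = x`.
  have key : ∀ᶠ t : ℝ in nhds 0, x + t • (y - x) ∈ feasible A b := by
    refine Filter.eventually_all.2 fun i => ?_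
    have hval : ∀ t : ℝ, A.mulVec (x + t • (y - x)).ofLp i
        = A.mulVec x.ofLp i + t * (A.mulVec y.ofLp i - A.mulVec x.ofLp i) := by
      intro t
      simp [Matrix.mulVec_add, Matrix.mulVec_smul, Matrix.mulVec_sub]
    by_cases h : A.mulVec x.ofLp i = b i
    · refine Filter.Eventually.of_forall fun t => ?_
      rw [hval, h, hxy i h]
      simp
    · have hlt : A.mulVec x.ofLp i < b i := lt_of_le_of_ne (hx.1 i) h
      have hc : ContinuousAt (fun t : ℝ => A.mulVec x.ofLp i
          + t * (A.mulVec y.ofLp i - A.mulVec x.ofLp i)) 0 := by fun_prop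
      have := hc.eventually_lt (continuousAt_const (y := b i)) (by simpa using hlt)
      filter_upwards [this] with t ht
      rw [hval]
      exact ht.le
  obtain ⟨r, hr, hball⟩ := Metric.eventually_nhds_iff.1 key
  have h1 := hball (y := r / 2) (by rw [Real.dist_eq, sub_zero, abs_of_pos] <;> linarith)
  have h2 := hball (y := -(r / 2)) (by rw [Real.dist_eq, sub_zero, abs_neg, abs_of_pos] <;> linarith)
  have hseg : x ∈ openSegment ℝ (x + (r / 2) • (y - x)) (x + (-(r / 2)) • (y - x)) :=
    ⟨1 / 2, 1 / 2, by norm_num, by norm_num, by norm_num, by module⟩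
  have h3 := hx.2 h1 h2 hseg
  have h4 : (r / 2) • (y - x) = 0 := by simpa using h3
  rcases smul_eq_zero.1 h4 with h | h
  · linarith
  · exact (sub_eq_zero.1 h).symm

theorem finite_extremePoints_feasible {d m : ℕ} (A : Matrix (Fin m) (Fin d) ℝ) (b : Fin m → ℝ) :
    ((feasible A b).extremePoints ℝ).Finite := by
  refine Set.Finite.of_injOn (f := fun x : EuclideanSpace ℝ (Fin d) =>
    {i | A.mulVec x.ofLp i = b i}) (t := Set.univ) (fun _ _ => Set.mem_univ _) ?_ Set.finite_univ
  intro x hx y _ hxy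
  exact eq_of_active_eq hx fun i hi => (Set.ext_iff.1 hxy i).1 hi

/-! ### Analytic and probabilistic tools. -/

/-- The descent lemma on a convex set. -/
theorem le_of_lipschitz_gradient {E : Type*} [NormedAddCommGroup E] [InnerProductSpace ℝ E]
    [CompleteSpace E] {K : Set E} (hK : Convex ℝ K) {f : E → ℝ}
    (hdiff : ∀ x ∈ K, DifferentiableAt ℝ f x) {L : ℝ}
    (hLip : ∀ x ∈ K, ∀ y ∈ K, ‖gradient f x - gradient f y‖ ≤ L * ‖x - y‖)
    {x y : E} (hx : x ∈ K) (hy : y ∈ K) :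
    f y ≤ f x + inner ℝ (gradient f x) (y - x) + L / 2 * ‖y - x‖ ^ 2 := by
  have hmem : ∀ t ∈ Set.Icc (0 : ℝ) 1, x + t • (y - x) ∈ K := fun t ht =>
    hK.add_smul_sub_mem hx hy ht
  -- Along the segment, `f` minus its quadratic upper model has nonpositive derivative by the
  -- Lipschitz bound; comparing `t = 0` with `t = 1` gives the claim.
  have hder : ∀ t ∈ Set.Icc (0 : ℝ) 1, HasDerivAt (fun t : ℝ => f (x + t • (y - x))
      - t * inner ℝ (gradient f x) (y - x) - L / 2 * t ^ 2 * ‖y - x‖ ^ 2)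
      (inner ℝ (gradient f (x + t • (y - x))) (y - x) - inner ℝ (gradient f x) (y - x)
        - L * t * ‖y - x‖ ^ 2) t := by
    intro t ht
    have h1 : HasDerivAt (fun t : ℝ => x + t • (y - x)) (y - x) t := by
      simpa using ((hasDerivAt_id t).smul_const (y - x)).const_add x
    have h2 := (hdiff _ (hmem t ht)).hasGradientAt.hasFDerivAt.comp_hasDerivAt t h1
    rw [InnerProductSpace.toDual_apply_apply] at h2
    have h3 := (hasDerivAt_id t).mul_const (inner ℝ (gradient f x) (y - x))
    have h4 := (((hasDerivAt_id t).pow 2).const_mul (L / 2)).mul_const (‖y - x‖ ^ 2)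
    refine ((h2.sub h3).sub h4).congr_deriv ?_
    simp only [id, Nat.cast_ofNat, Nat.add_one_sub_one, pow_one]
    ring
  have hanti : AntitoneOn (fun t : ℝ => f (x + t • (y - x))
      - t * inner ℝ (gradient f x) (y - x) - L / 2 * t ^ 2 * ‖y - x‖ ^ 2) (Set.Icc 0 1) := by
    refine antitoneOn_of_deriv_nonpos (convex_Icc 0 1)
      (fun t ht => (hder t ht).continuousAt.continuousWithinAt)
      (fun t ht => (hder t (interior_subset ht)).differentiableAt.differentiableWithinAt) ?_
    intro t ht
    have ht' := interior_subset ht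
    rw [(hder t ht').deriv, ← inner_sub_left]
    have h1 := real_inner_le_norm (gradient f (x + t • (y - x)) - gradient f x) (y - x)
    have h2 := hLip _ (hmem t ht') x hx
    rw [add_sub_cancel_left, norm_smul, Real.norm_of_nonneg ht'.1] at h2
    have h3 := mul_le_mul_of_nonneg_right h2 (norm_nonneg (y - x))
    nlinarith
  have := hanti (Set.left_mem_Icc.2 zero_le_one) (Set.right_mem_Icc.2 zero_le_one) zero_le_one
  simp only [one_smul, zero_smul, add_sub_cancel, add_zero] at this
  linarith

/-- Nothing is known about `f` and its gradient off the polytope, so they need not be measurable on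
the whole space; it is enough that the iterates never leave `K`. -/
theorem measurable_comp_of_continuousOn {Ω E F : Type*} {m : MeasurableSpace Ω}
    [TopologicalSpace E] [MeasurableSpace E] [BorelSpace E] [TopologicalSpace F]
    [MeasurableSpace F] [BorelSpace F] {K : Set E} {f : E → F}
    (hf : ContinuousOn f K) {X : Ω → E} (hX : Measurable X) (hXK : ∀ ω, X ω ∈ K) :
    Measurable fun ω => f (X ω) :=
  hf.domRestrict.measurable.comp (hX.subtype_mk (h := hXK))

/-- If `W ≤ a` with high conditional probability and `W ≤ B` always, then the conditional
expectation of `W` is small. -/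
theorem condExp_le_of_prob_le {Ω : Type*} {m m0 : MeasurableSpace Ω} (hm : m ≤ m0)
    (P : Measure Ω) [IsProbabilityMeasure P] {W : Ω → ℝ} (hW : Measurable W) (hW0 : ∀ ω, 0 ≤ W ω)
    {E τ : Set Ω} (hE : MeasurableSet E) (hτ : MeasurableSet[m] τ) {a B p c : ℝ}
    (haB : a ≤ B) (hWB : ∀ ω, W ω ≤ B) (hWa : ∀ ω ∈ E, ω ∈ τ → W ω ≤ a)
    (hp : ∀ᵐ ω ∂P, ω ∈ τ → p ≤ (P⟦E|m⟧) ω) (hc : B - (B - a) * p ≤ c) (hc0 : 0 ≤ c) :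
    Integrable W P ∧ ∀ᵐ ω ∂P, τ.indicator (P[W|m]) ω ≤ c := by
  have hWi : Integrable W P := by
    refine Integrable.of_bound hW.aestronglyMeasurable B (Filter.Eventually.of_forall fun ω => ?_)
    rw [Real.norm_of_nonneg (hW0 ω)]
    exact hWB ω
  refine ⟨hWi, ?_⟩
  have hEi : Integrable (E.indicator fun _ => (1 : ℝ)) P :=
    (integrable_const 1).indicator hE
  have hEτi : Integrable (τ.indicator (E.indicator fun _ => (1 : ℝ))) P := hEi.indicator (hm _ hτ)
  -- A pointwise bound that is affine in the indicator of `E ∩ τ`. Since `τ` is `m`-measurable, its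
  -- indicator comes out of the conditional expectation and leaves the conditional probability of
  -- `E`.
  have hle : W ≤ᵐ[P] (fun _ => B) - (B - a) • τ.indicator (E.indicator fun _ => (1 : ℝ)) := by
    refine Filter.Eventually.of_forall fun ω => ?_
    by_cases h1 : ω ∈ τ
    · by_cases h2 : ω ∈ E
      · simpa [h1, h2] using hWa ω h2 h1
      · simpa [h1, h2] using hWB ω
    · simpa [h1] using hWB ω
  have h1 := condExp_mono (m := m) hWi ((integrable_const B).sub (hEτi.smul (B - a))) hle
  have h2 := condExp_sub (integrable_const B) (hEτi.smul (B - a)) m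
  have h3 := condExp_smul (μ := P) (B - a) (τ.indicator (E.indicator fun _ => (1 : ℝ))) m
  have h4 := condExp_indicator hEi hτ
  filter_upwards [h1, h2, h3, h4, hp] with ω h1 h2 h3 h4 hp
  by_cases hω : ω ∈ τ
  · rw [Set.indicator_of_mem hω]
    rw [h2, Pi.sub_apply, h3, Pi.smul_apply, h4, Set.indicator_of_mem hω, condExp_const hm] at h1
    have := mul_le_mul_of_nonneg_left (hp hω) (sub_nonneg.2 haB)
    simp only [smul_eq_mul] at h1
    linarith
  · rw [Set.indicator_of_notMem hω]
    exact hc0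

/-! ### Vertex representations and deterministic one-step progress. -/

section Deterministic

variable {d : ℕ} {K : Set (EuclideanSpace ℝ (Fin d))}

/-- The weights `α` represent `x` as a convex combination of vertices of `K`. -/
structure IsVertexRepr (K : Set (EuclideanSpace ℝ (Fin d))) (x : EuclideanSpace ℝ (Fin d))
    (α : EuclideanSpace ℝ (Fin d) →₀ ℝ) : Prop where
  vertices : ∀ v ∈ α.support, v ∈ K.extremePoints ℝ
  nonneg : ∀ v, 0 ≤ α v
  sum_eq : (α.sum fun _ a => a) = 1
  eq_sum : x = α.sum fun v a => a • v

theorem IsVertexRepr.mem (hK : Convex ℝ K) {x : EuclideanSpace ℝ (Fin d)}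
    {α : EuclideanSpace ℝ (Fin d) →₀ ℝ} (h : IsVertexRepr K x α) : x ∈ K := by
  rw [h.eq_sum]
  exact hK.sum_mem (fun v _ => h.nonneg v) h.sum_eq fun v hv => (h.vertices v hv).1

theorem IsVertexRepr.inner_le {x g v : EuclideanSpace ℝ (Fin d)}
    {α : EuclideanSpace ℝ (Fin d) →₀ ℝ} (h : IsVertexRepr K x α)
    (hv : ∀ u ∈ α.support, inner ℝ g u ≤ inner ℝ g v) : inner ℝ g x ≤ inner ℝ g v := by
  calc inner ℝ g x = ∑ u ∈ α.support, α u * inner ℝ g u := by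
        rw [h.eq_sum, Finsupp.sum, inner_sum]
        simp [inner_smul_right]
    _ ≤ ∑ u ∈ α.support, α u * inner ℝ g v :=
        Finset.sum_le_sum fun u hu => mul_le_mul_of_nonneg_left (hv u hu) (h.nonneg u)
    _ = inner ℝ g v := by
        rw [← Finset.sum_mul]
        have := h.sum_eq
        rw [Finsupp.sum] at this
        rw [this, one_mul]

theorem IsVertexRepr.le_one {x : EuclideanSpace ℝ (Fin d)}
    {α : EuclideanSpace ℝ (Fin d) →₀ ℝ} (h : IsVertexRepr K x α)
    (v : EuclideanSpace ℝ (Fin d)) : α v ≤ 1 := by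
  by_cases hv : v ∈ α.support
  · rw [← h.sum_eq]
    exact Finset.single_le_sum (f := fun u => α u) (fun u _ => h.nonneg u) hv
  · rw [Finsupp.notMem_support_iff.1 hv]
    exact zero_le_one

theorem IsVertexRepr.eq_of_weight_eq_one {x v : EuclideanSpace ℝ (Fin d)}
    {α : EuclideanSpace ℝ (Fin d) →₀ ℝ} (h : IsVertexRepr K x α) (hv : α v = 1) : x = v := by
  have hvs : v ∈ α.support := by simp [hv]
  have h0 : ∀ u ∈ α.support.erase v, α u = 0 := by
    refine (Finset.sum_eq_zero_iff_of_nonneg fun u _ => h.nonneg u).1 ?_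
    have h1 := Finset.add_sum_erase α.support (fun u => α u) hvs
    have h2 := h.sum_eq
    rw [Finsupp.sum] at h2
    simp only [h2, hv] at h1
    linarith
  rw [h.eq_sum, Finsupp.sum, Finset.sum_eq_single_of_mem v hvs, hv, one_smul]
  intro u hu huv
  rw [h0 u (Finset.mem_erase.2 ⟨huv, hu⟩), zero_smul]

/-- Moving mass `γ` towards the vertex `s`. -/
theorem IsVertexRepr.toward {x s : EuclideanSpace ℝ (Fin d)}
    {α : EuclideanSpace ℝ (Fin d) →₀ ℝ} (h : IsVertexRepr K x α) (hs : s ∈ K.extremePoints ℝ)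
    {γ : ℝ} (h0 : 0 ≤ γ) (h1 : γ ≤ 1) :
    IsVertexRepr K (x + γ • (s - x)) ((1 - γ) • α + Finsupp.single s γ) := by
  refine ⟨fun v hv => ?_, fun v => ?_, ?_, ?_⟩
  · rcases Finset.mem_union.1 (Finsupp.support_add hv) with hv | hv
    · exact h.vertices v (Finsupp.support_smul hv)
    · rw [Finset.mem_singleton.1 (Finsupp.support_single_subset hv)]
      exact hs
  · rw [Finsupp.add_apply, Finsupp.smul_apply, smul_eq_mul]
    have h2 : 0 ≤ Finsupp.single s γ v := by
      rw [Finsupp.single_apply]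
      split_ifs <;> simp [h0]
    have := mul_nonneg (sub_nonneg.2 h1) (h.nonneg v)
    linarith
  · rw [Finsupp.sum_add_index' (fun _ => rfl) (fun _ _ _ => rfl),
      Finsupp.sum_smul_index (fun _ => rfl), Finsupp.sum_single_index rfl, ← Finsupp.mul_sum,
      h.sum_eq]
    ring
  · rw [Finsupp.sum_add_index' (h := fun v a => a • v) (fun _ => zero_smul ℝ _)
        (fun _ _ _ => add_smul _ _ _),
      Finsupp.sum_smul_index (h := fun v a => a • v) (fun _ => zero_smul ℝ _),
      Finsupp.sum_single_index (h := fun v a => a • v) (zero_smul ℝ _)]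
    simp only [mul_smul]
    rw [← Finsupp.smul_sum, ← h.eq_sum]
    module

/-- Moving mass `γ` away from the vertex `v`. -/
theorem IsVertexRepr.away {x v : EuclideanSpace ℝ (Fin d)}
    {α : EuclideanSpace ℝ (Fin d) →₀ ℝ} (h : IsVertexRepr K x α) (hv : v ∈ α.support)
    {γ : ℝ} (h0 : 0 ≤ γ) (h1 : γ * (1 - α v) ≤ α v) :
    IsVertexRepr K (x + γ • (x - v)) ((1 + γ) • α - Finsupp.single v γ) := by
  rw [sub_eq_add_neg (_ • α), ← Finsupp.single_neg]
  refine ⟨fun u hu => ?_, fun u => ?_, ?_, ?_⟩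
  · rcases Finset.mem_union.1 (Finsupp.support_add hu) with hu | hu
    · exact h.vertices u (Finsupp.support_smul hu)
    · rw [Finset.mem_singleton.1 (Finsupp.support_single_subset hu)]
      exact h.vertices v hv
  · rw [Finsupp.add_apply, Finsupp.smul_apply, smul_eq_mul, Finsupp.single_apply]
    split_ifs with huv
    · subst huv
      linarith
    · have := mul_nonneg h0 (h.nonneg u)
      have := h.nonneg u
      linarith
  · rw [Finsupp.sum_add_index' (fun _ => rfl) (fun _ _ _ => rfl),
      Finsupp.sum_smul_index (fun _ => rfl), Finsupp.sum_single_index rfl, ← Finsupp.mul_sum,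
      h.sum_eq]
    ring
  · rw [Finsupp.sum_add_index' (h := fun v a => a • v) (fun _ => zero_smul ℝ _)
        (fun _ _ _ => add_smul _ _ _),
      Finsupp.sum_smul_index (h := fun v a => a • v) (fun _ => zero_smul ℝ _),
      Finsupp.sum_single_index (h := fun v a => a • v) (zero_smul ℝ _)]
    simp only [mul_smul]
    rw [← Finsupp.smul_sum, ← h.eq_sum]
    module

theorem card_support_toward_le (α : EuclideanSpace ℝ (Fin d) →₀ ℝ)
    (s : EuclideanSpace ℝ (Fin d)) (γ : ℝ) :
    ((1 - γ) • α + Finsupp.single s γ).support.card ≤ α.support.card + 1 := by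
  classical
  refine (Finset.card_le_card ?_).trans (Finset.card_insert_le s α.support)
  intro v hv
  rcases Finset.mem_union.1 (Finsupp.support_add hv) with hv | hv
  · exact Finset.mem_insert_of_mem (Finsupp.support_smul hv)
  · exact Finset.mem_insert.2 (.inl (Finset.mem_singleton.1 (Finsupp.support_single_subset hv)))

theorem support_away_subset {α : EuclideanSpace ℝ (Fin d) →₀ ℝ} {v : EuclideanSpace ℝ (Fin d)}
    (hv : v ∈ α.support) (γ : ℝ) :
    ((1 + γ) • α - Finsupp.single v γ).support ⊆ α.support := by
  classical
  intro u hu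
  rcases Finset.mem_union.1 (Finsupp.support_sub hu) with hu | hu
  · exact Finsupp.support_smul hu
  · rwa [Finset.mem_singleton.1 (Finsupp.support_single_subset hu)]

/-- In the away branch the iterate differs from the away vertex. -/
theorem IsVertexRepr.weight_lt_one {x g v : EuclideanSpace ℝ (Fin d)}
    {α : EuclideanSpace ℝ (Fin d) →₀ ℝ} (h : IsVertexRepr K x α)
    (hr : 0 < -inner ℝ g (x - v)) : α v < 1 := by
  refine lt_of_le_of_ne (h.le_one v) fun h1 => ?_
  rw [h.eq_of_weight_eq_one h1] at hr
  simp at hr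

/-- An away-step iteration preserves the representation and activates at most one vertex. -/
theorem IsVertexRepr.next (hK : Convex ℝ K) {L : ℝ} (hL : 0 < L)
    {x g s v : EuclideanSpace ℝ (Fin d)}
    {α : EuclideanSpace ℝ (Fin d) →₀ ℝ} (h : IsVertexRepr K x α) (hs : IsVertexSolution K g s)
    (hv : v ∈ α.support) :
    IsVertexRepr K (awayStep L x g s v α).1 (awayStep L x g s v α).2 ∧
      (awayStep L x g s v α).2.support.card ≤ α.support.card + 1 := by
  have hr : 0 ≤ -inner ℝ g (s - x) := by
    rw [inner_sub_right]
    linarith [hs.2 x (h.mem hK)]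
  unfold FrankWolfe.awayStep
  split_ifs with hb
  · refine ⟨h.toward hs.1 (le_min zero_le_one (by positivity)) (min_le_left _ _), ?_⟩
    exact card_support_toward_le _ _ _
  · have hr' : 0 < -inner ℝ g (x - v) := by linarith
    have h1 : 0 < 1 - α v := sub_pos.2 (h.weight_lt_one hr')
    refine ⟨h.away hv (le_min (div_nonneg (h.nonneg v) h1.le) (by positivity)) ?_, ?_⟩
    · rw [← le_div_iff₀ h1]
      exact min_le_left _ _
    · exact (Finset.card_le_card (support_away_subset hv _)).trans (Nat.le_succ _)

/-- The decrease in objective for a step along `u` with a step size at most the short step, when the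
gradient estimate is good. -/
theorem step_decrease (hK : Convex ℝ K) {f : EuclideanSpace ℝ (Fin d) → ℝ}
    (hdiff : ∀ x ∈ K, DifferentiableAt ℝ f x) {L : ℝ} (hL : 0 < L)
    (hLip : ∀ x ∈ K, ∀ y ∈ K, ‖gradient f x - gradient f y‖ ≤ L * ‖x - y‖)
    {x g u : EuclideanSpace ℝ (Fin d)} {γ η r : ℝ} (hx : x ∈ K) (hxu : x + γ • u ∈ K)
    (hr : r = -inner ℝ g u) (hr0 : 0 < r) (hγ0 : 0 ≤ γ) (hγ : γ ≤ r / (L * ‖u‖ ^ 2))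
    (herr : ‖g - gradient f x‖ * ‖u‖ ≤ η * r) :
    f (x + γ • u) ≤ f x - (1 / 2 - η) * (γ * r) := by
  have hu : 0 < ‖u‖ := by
    refine norm_pos_iff.2 fun h => ?_
    rw [hr, h] at hr0
    simp at hr0
  have h1 := le_of_lipschitz_gradient hK hdiff hLip hx hxu
  rw [add_sub_cancel_left, inner_smul_right, norm_smul, Real.norm_of_nonneg hγ0] at h1
  have h2 : inner ℝ (gradient f x) u ≤ -(1 - η) * r := by
    have h3 := real_inner_le_norm (gradient f x - g) u
    rw [norm_sub_rev, inner_sub_left] at h3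
    linarith
  -- The quadratic term thus costs at most `γ * r / 2`, against a linear gain of at least `(1 - η) *
  -- γ * r`.
  have h3 : γ * (L * ‖u‖ ^ 2) ≤ r := (le_div_iff₀ (by positivity)).1 hγ
  have h4 := mul_le_mul_of_nonneg_left h2 hγ0
  have h5 := mul_le_mul_of_nonneg_left h3 hγ0
  nlinarith

/-- Progress of an away-step iteration with a good gradient estimate. -/
theorem IsVertexRepr.next_progress (hK : Convex ℝ K) (hKb : Bornology.IsBounded K)
    {f : EuclideanSpace ℝ (Fin d) → ℝ}
    (hdiff : ∀ x ∈ K, DifferentiableAt ℝ f x) {L : ℝ} (hL : 0 < L)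
    (hLip : ∀ x ∈ K, ∀ y ∈ K, ‖gradient f x - gradient f y‖ ≤ L * ‖x - y‖)
    {ε εg : ℝ} (hε : 0 < ε) (hεg : 0 < εg) (hεg_lt : 4 * Metric.diam K * εg < 1)
    {x y g s v : EuclideanSpace ℝ (Fin d)} {α : EuclideanSpace ℝ (Fin d) →₀ ℝ}
    (h : IsVertexRepr K x α) (hs : IsVertexSolution K g s)
    (hv : v ∈ α.support) (hvmax : ∀ u ∈ α.support, inner ℝ g u ≤ inner ℝ g v)
    (hy : y ∈ K) (hxy : ε ≤ inner ℝ (gradient f x) (x - y))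
    (hgood : ‖g - gradient f x‖ ≤ εg * inner ℝ g (v - s)) :
    (f (awayStep L x g s v α).1 ≤ f x - (1 / 2 - 2 * Metric.diam K * εg) *
        min ((2 * ε / 5) ^ 2 / (L * (Metric.diam K ^ 2 + 1))) (2 * ε / 5) ∧
      (awayStep L x g s v α).2.support.card ≤ α.support.card + 1) ∨
    (f (awayStep L x g s v α).1 ≤ f x ∧
      (awayStep L x g s v α).2.support.card + 1 ≤ α.support.card) := by
  obtain ⟨hrep, hcard⟩ := h.next hK hL hs hv
  have hxK := h.mem hK
  have hvK : v ∈ K := (h.vertices v hv).1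
  have hnext := hrep.mem hK
  have hgx := h.inner_le hvmax
  have hdist : ∀ a ∈ K, ∀ b ∈ K, ‖a - b‖ ≤ Metric.diam K := fun a ha b hb => by
    rw [← dist_eq_norm]
    exact Metric.dist_le_diam_of_mem hKb ha hb
  set D := Metric.diam K with hD
  have hD0 : 0 ≤ D := Metric.diam_nonneg
  have hη : 0 < 1 / 2 - 2 * D * εg := by linarith
  have hgap0 : 0 ≤ inner ℝ g (v - s) := by
    rw [inner_sub_right]
    linarith [hs.2 v hvK]
  set gap := inner ℝ g (v - s) with hgap
  have herr : ∀ u : EuclideanSpace ℝ (Fin d), ‖u‖ ≤ D → ‖g - gradient f x‖ * ‖u‖ ≤ εg * gap * D :=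
    fun u hu => mul_le_mul hgood hu (norm_nonneg _) (by positivity)
  -- Replacing the gradient by `g` costs at most `εg * gap * D ≤ gap / 4`, hence `ε ≤ 5 / 4 * gap`.
  have hgap_ge : 2 * ε / 5 ≤ gap / 2 := by
    have h1 := real_inner_le_norm (gradient f x - g) (x - y)
    have h2 := herr _ (hdist x hxK y hy)
    rw [norm_sub_rev, inner_sub_left] at h1
    have h3 : inner ℝ g (x - y) ≤ gap := by
      rw [hgap, inner_sub_right, inner_sub_right]
      linarith [hs.2 y hy]
    have h4 : 4 * D * εg * gap ≤ 1 * gap := mul_le_mul_of_nonneg_right hεg_lt.le hgap0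
    linarith
  have hbig : ∀ (u : EuclideanSpace ℝ (Fin d)) (r : ℝ), ‖u‖ ≤ D → gap / 2 ≤ r →
      ‖g - gradient f x‖ * ‖u‖ ≤ 2 * D * εg * r := fun u r hu hr => by
    refine (herr u hu).trans ?_
    have := mul_le_mul_of_nonneg_left hr (mul_nonneg hD0 hεg.le)
    linarith
  -- Using `D ^ 2 + 1` in place of `D ^ 2` keeps the constant positive and defined when `D = 0`.
  have hquot : ∀ (u : EuclideanSpace ℝ (Fin d)) (r : ℝ), ‖u‖ ≤ D → gap / 2 ≤ r →
      r = -inner ℝ g u →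
      (2 * ε / 5) ^ 2 / (L * (D ^ 2 + 1)) ≤ r / (L * ‖u‖ ^ 2) * r := fun u r hu hr hru => by
    have hr0 : 0 < r := by linarith
    have hu0 : 0 < ‖u‖ := by
      refine norm_pos_iff.2 fun h => ?_
      rw [hru, h] at hr0
      simp at hr0
    rw [div_mul_eq_mul_div, ← pow_two]
    have h1 : 2 * ε / 5 ≤ r := hgap_ge.trans hr
    have h2 : ‖u‖ ^ 2 ≤ D ^ 2 + 1 := by
      have := pow_le_pow_left₀ hu0.le hu 2
      linarith
    gcongr
  -- The algorithm takes the larger of these two scores, so the chosen direction has score at least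
  -- `gap / 2`.
  have hsum : -inner ℝ g (s - x) + -inner ℝ g (x - v) = gap := by
    rw [hgap, inner_sub_right, inner_sub_right, inner_sub_right]
    ring
  unfold FrankWolfe.awayStep at hnext hcard ⊢
  split_ifs at hnext hcard ⊢ with hb
  · left
    refine ⟨?_, hcard⟩
    have hr : gap / 2 ≤ -inner ℝ g (s - x) := by linarith
    have hr0 : 0 < -inner ℝ g (s - x) := by linarith
    have hu := hdist s hs.1.1 x hxK
    have h1 := step_decrease hK hdiff hL hLip hxK hnext rfl hr0
      (le_min zero_le_one (by positivity)) (min_le_right _ _) (hbig _ _ hu hr)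
    refine h1.trans (sub_le_sub_left (mul_le_mul_of_nonneg_left ?_ hη.le) _)
    rw [min_mul_of_nonneg _ _ hr0.le, min_comm, one_mul]
    exact min_le_min (hgap_ge.trans hr) (hquot _ _ hu hr rfl)
  · have hr : gap / 2 ≤ -inner ℝ g (x - v) := by linarith
    have hr0 : 0 < -inner ℝ g (x - v) := by linarith
    have hu := hdist x hxK v hvK
    have hα : 0 < 1 - α v := sub_pos.2 (h.weight_lt_one hr0)
    have h1 := step_decrease hK hdiff hL hLip hxK hnext rfl hr0
      (le_min (div_nonneg (h.nonneg v) hα.le) (by positivity)) (min_le_right _ _) (hbig _ _ hu hr)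
    -- A maximal away step may be arbitrarily short, so no fixed decrease of `f` is available;
    -- instead the new weight of `v`, namely `(1 + γ) * α v - γ`, vanishes.
    rcases le_total (α v / (1 - α v)) (-inner ℝ g (x - v) / (L * ‖x - v‖ ^ 2)) with hγ | hγ
    · right
      refine ⟨h1.trans (sub_le_self _ (mul_nonneg hη.le (mul_nonneg
        (le_min (div_nonneg (h.nonneg v) hα.le) (by positivity)) hr0.le))), ?_⟩
      simp only [min_eq_left hγ]
      refine Finset.card_lt_card (Finset.ssubset_iff_of_subset (support_away_subset hv _) |>.2
        ⟨v, hv, ?_⟩)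
      rw [Finsupp.notMem_support_iff, Finsupp.sub_apply, Finsupp.smul_apply, smul_eq_mul,
        Finsupp.single_eq_same]
      field_simp
      ring
    · left
      refine ⟨h1.trans (sub_le_sub_left (mul_le_mul_of_nonneg_left ?_ hη.le) _), hcard⟩
      rw [min_eq_right hγ]
      exact (min_le_left _ _).trans (hquot _ _ hu hr rfl)

/-- Progress of a standard Frank-Wolfe iteration with a good gradient estimate. -/
theorem standardStep_progress (hK : Convex ℝ K) (hKb : Bornology.IsBounded K)
    {f : EuclideanSpace ℝ (Fin d) → ℝ}
    (hdiff : ∀ x ∈ K, DifferentiableAt ℝ f x) {L : ℝ} (hL : 0 < L)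
    (hLip : ∀ x ∈ K, ∀ y ∈ K, ‖gradient f x - gradient f y‖ ≤ L * ‖x - y‖)
    {ε : ℝ} (hε : 0 < ε) {x y g s : EuclideanSpace ℝ (Fin d)} (hx : x ∈ K)
    (hs : IsVertexSolution K g s) (hy : y ∈ K) (hxy : ε ≤ inner ℝ (gradient f x) (x - y))
    (hgood : ‖g - gradient f x‖ ≤ ε / (4 * Metric.diam K)) :
    f (x + min 1 (ε / (2 * L * Metric.diam K ^ 2)) • (s - x)) ≤
      f x - min 1 (ε / (2 * L * (Metric.diam K ^ 2 + 1))) * (ε / 2) := by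
  have hdist : ∀ a ∈ K, ∀ b ∈ K, ‖a - b‖ ≤ Metric.diam K := fun a ha b hb => by
    rw [← dist_eq_norm]
    exact Metric.dist_le_diam_of_mem hKb ha hb
  -- If the diameter were 0, then `x = y` and the gap would vanish. This excludes the default value
  -- 0 of the quotients by `D`.
  have hD : 0 < Metric.diam K := by
    refine lt_of_le_of_ne Metric.diam_nonneg fun h0 => ?_
    have h1 := hdist x hx y hy
    rw [← h0, norm_le_zero_iff] at h1
    rw [h1, inner_zero_right] at hxy
    linarith
  set D := Metric.diam K
  set γ := min 1 (ε / (2 * L * D ^ 2)) with hγdef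
  have hγ0 : 0 ≤ γ := le_min zero_le_one (by positivity)
  have hγD : γ * (2 * L * D ^ 2) ≤ ε := (le_div_iff₀ (by positivity)).1 (min_le_right _ _)
  have hnext : x + γ • (s - x) ∈ K := hK.add_smul_sub_mem hx hs.1.1 ⟨hγ0, min_le_left _ _⟩
  have h1 := le_of_lipschitz_gradient hK hdiff hLip hx hnext
  rw [add_sub_cancel_left, inner_smul_right, norm_smul, Real.norm_of_nonneg hγ0] at h1
  -- Split `s - x` as `(s - y) + (y - x)`: the second part contributes at most `-ε`, and on the
  -- first `g` is nonpositive, with error at most `ε / 4`. The quadratic term below costs another `γ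
  -- * ε / 4`, leaving a decrease of `γ * ε / 2`.
  have h2 : inner ℝ (gradient f x) (s - x) ≤ -(3 / 4 * ε) := by
    have h3 := real_inner_le_norm (gradient f x - g) (s - y)
    have h4 : ‖g - gradient f x‖ * ‖s - y‖ ≤ ε / (4 * D) * D :=
      mul_le_mul hgood (hdist s hs.1.1 y hy) (norm_nonneg _) (by positivity)
    have h5 : ε / (4 * D) * D = ε / 4 := by field_simp
    rw [norm_sub_rev, inner_sub_left, inner_sub_right, inner_sub_right] at h3
    rw [inner_sub_right] at hxy ⊢
    linarith [hs.2 y hy]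
  have h3 := mul_le_mul_of_nonneg_left h2 hγ0
  have h4 : ‖s - x‖ ^ 2 ≤ D ^ 2 := pow_le_pow_left₀ (norm_nonneg _) (hdist s hs.1.1 x hx) 2
  have h5 : L / 2 * (γ * ‖s - x‖) ^ 2 ≤ γ * (ε / 4) := by
    have h6 := mul_le_mul_of_nonneg_left h4 (by positivity : 0 ≤ L / 2 * γ ^ 2)
    have h7 := mul_le_mul_of_nonneg_left hγD (by positivity : 0 ≤ γ / 4)
    linarith
  have h6 : min 1 (ε / (2 * L * (D ^ 2 + 1))) ≤ γ := by
    refine min_le_min le_rfl ?_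
    gcongr
    linarith
  have h7 := mul_le_mul_of_nonneg_right h6 (by positivity : 0 ≤ ε / 2)
  linarith

end Deterministic

/-! ### Random runs: invariants and measurability. -/

section Processes

variable {d : ℕ} {Ω : Type*} {K : Set (EuclideanSpace ℝ (Fin d))}
  {f : EuclideanSpace ℝ (Fin d) → ℝ} {L ε : ℝ}

/-- This expresses `k < T` through the iterates up to time `k` alone, which puts the event in `ℱ_k`.
-/
theorem lt_terminalTime_iff {X : ℕ → Ω → EuclideanSpace ℝ (Fin d)} {ω : Ω} {k : ℕ} :
    (k : ℕ∞) < terminalTime K f ε X ω ↔ ∀ j ≤ k, ε < f (X j ω) - optVal K f := by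
  constructor
  · intro h j hj
    by_contra! hc
    have h1 : terminalTime K f ε X ω ≤ j := sInf_le ⟨j, rfl, hc⟩
    exact absurd (h.trans_le h1) (by simpa using hj)
  · intro h
    have h1 : ((k + 1 : ℕ) : ℕ∞) ≤ terminalTime K f ε X ω := by
      refine le_sInf ?_
      rintro _ ⟨j, rfl, hj⟩
      by_contra! hc
      exact absurd hj (not_le.2 (h j (Nat.lt_succ_iff.1 (Nat.cast_lt.1 hc))))
    exact (Nat.cast_lt.2 k.lt_succ_self).trans_le h1

theorem measurableSet_lt_terminalTime {m : MeasurableSpace Ω} (hf : ContinuousOn f K)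
    {X : ℕ → Ω → EuclideanSpace ℝ (Fin d)} (hXK : ∀ j ω, X j ω ∈ K) {k : ℕ}
    (hX : ∀ j ≤ k, Measurable (X j)) :
    MeasurableSet {ω | (k : ℕ∞) < terminalTime K f ε X ω} := by
  simp only [lt_terminalTime_iff, Set.ofPred_forall]
  exact MeasurableSet.iInter fun j => MeasurableSet.iInter fun hj =>
    measurableSet_lt measurable_const
      ((measurable_comp_of_continuousOn hf (hX j hj) (hXK j)).sub_const _)

variable [MeasurableSpace Ω]

namespace StandardRun

theorem measurable_X_filtration (R : StandardRun K f L ε Ω) {j k : ℕ} (hj : j ≤ k) :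
    Measurable[R.filtration k] (R.X j) :=
  (comap_measurable (R.X j)).mono ((le_iSup₂_of_le (f := fun i (_ : i ≤ k) =>
    MeasurableSpace.comap (R.X i) inferInstance) j hj le_rfl).trans le_sup_right) le_rfl

theorem X_mem (hK : Convex ℝ K) (hL : 0 < L) (hε : 0 < ε) (R : StandardRun K f L ε Ω)
    (k : ℕ) (ω : Ω) : R.X k ω ∈ K := by
  induction k with
  | zero => exact R.init ω
  | succ k ih =>
    rcases lt_or_ge (k : ℕ∞) (terminalTime K f ε R.X ω) with h | h
    · rw [R.step k ω h]
      exact hK.add_smul_sub_mem ih (R.lp k ω h).1.1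
        ⟨le_min zero_le_one (by positivity), min_le_left _ _⟩
    · rw [(R.stopped k ω h).1]
      exact ih

theorem Φ_ratio (R : StandardRun K f L ε Ω) (k : ℕ) (ω : Ω) :
    R.Φ (k + 1) ω / R.Φ k ω = Real.exp (f (R.X (k + 1) ω) - f (R.X k ω)) := by
  rw [Φ, Φ, ← Real.exp_sub]
  congr 1
  ring

theorem measurable_Φ (hf : ContinuousOn f K) (R : StandardRun K f L ε Ω)
    (hXK : ∀ k ω, R.X k ω ∈ K) (k : ℕ) : Measurable (R.Φ k) :=
  ((measurable_comp_of_continuousOn hf (R.measurable_X k) (hXK k)).sub_const _).exp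

theorem measurableSet_goodEvent (hf' : ContinuousOn (gradient f) K) (R : StandardRun K f L ε Ω)
    (hXK : ∀ k ω, R.X k ω ∈ K) (k : ℕ) : MeasurableSet (R.goodEvent k) :=
  measurableSet_le ((R.measurable_G k).sub
    (measurable_comp_of_continuousOn hf' (R.measurable_X k) (hXK k))).norm measurable_const

end StandardRun

namespace AwayRun

theorem measurable_X_filtration (R : AwayRun K f L ε Ω) {j k : ℕ} (hj : j ≤ k) :
    Measurable[R.filtration k] (R.X j) :=
  (comap_measurable (R.X j)).mono ((le_iSup₂_of_le (f := fun i (_ : i ≤ k) =>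
    MeasurableSpace.comap (R.X i) inferInstance) j hj le_rfl).trans le_sup_right) le_rfl

theorem X_succ (R : AwayRun K f L ε Ω) {k : ℕ} {ω : Ω} (h : (k : ℕ∞) < R.T ω) :
    R.X (k + 1) ω = (awayStep L (R.X k ω) (R.G k ω) (R.S k ω) (R.V k ω) (R.α k ω)).1 :=
  congrArg Prod.fst (R.step k ω h)

theorem α_succ (R : AwayRun K f L ε Ω) {k : ℕ} {ω : Ω} (h : (k : ℕ∞) < R.T ω) :
    R.α (k + 1) ω = (awayStep L (R.X k ω) (R.G k ω) (R.S k ω) (R.V k ω) (R.α k ω)).2 :=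
  congrArg Prod.snd (R.step k ω h)

theorem isVertexRepr (hK : Convex ℝ K) (hL : 0 < L) (R : AwayRun K f L ε Ω)
    (k : ℕ) (ω : Ω) : IsVertexRepr K (R.X k ω) (R.α k ω) := by
  induction k with
  | zero => exact ⟨R.init_vertices ω, R.init_nonneg ω, R.init_sum ω, R.init ω⟩
  | succ k ih =>
    rcases lt_or_ge (k : ℕ∞) (R.T ω) with h | h
    · rw [R.X_succ h, R.α_succ h]
      exact (ih.next hK hL (R.lp k ω h) (R.away k ω h).1).1
    · rw [(R.stopped k ω h).1, (R.stopped k ω h).2.2.2.2]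
      exact ih

/-- Valid for bad estimates and after stopping too, so it bounds the ratio of `Φ` everywhere. -/
theorem card_U_succ_le (hK : Convex ℝ K) (hL : 0 < L) (R : AwayRun K f L ε Ω)
    (k : ℕ) (ω : Ω) : (R.U (k + 1) ω).card ≤ (R.U k ω).card + 1 := by
  rcases lt_or_ge (k : ℕ∞) (R.T ω) with h | h
  · rw [U, R.α_succ h]
    exact ((R.isVertexRepr hK hL k ω).next hK hL (R.lp k ω h) (R.away k ω h).1).2
  · rw [U, (R.stopped k ω h).2.2.2.2]
    exact Nat.le_succ _

theorem Φ_ratio (R : AwayRun K f L ε Ω) (ν : ℝ) (k : ℕ) (ω : Ω) :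
    R.Φ ν (k + 1) ω / R.Φ ν k ω = Real.exp (ν * (f (R.X (k + 1) ω) - f (R.X k ω))
      + (1 - ν) * ((R.U (k + 1) ω).card - (R.U k ω).card)) := by
  rw [Φ, Φ, ← Real.exp_sub]
  congr 1
  ring

theorem measurable_card_U (hK : Convex ℝ K) (hL : 0 < L) (hfin : (K.extremePoints ℝ).Finite)
    (R : AwayRun K f L ε Ω) (k : ℕ) : Measurable fun ω => ((R.U k ω).card : ℝ) := by
  -- The random active set always lies in the fixed finite vertex set, so its size is a fixed finite
  -- sum of measurable indicators.
  have h : (fun ω => ((R.U k ω).card : ℝ)) = fun ω => ∑ v ∈ hfin.toFinset,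
      (fun a : ℝ => if a = 0 then (0 : ℝ) else 1) (R.α k ω v) := by
    classical
    funext ω
    have hsub : R.U k ω = hfin.toFinset.filter fun v => R.α k ω v ≠ 0 := by
      ext v
      simp only [U, Finset.mem_filter, Set.Finite.mem_toFinset, Finsupp.mem_support_iff]
      exact ⟨fun hv => ⟨(R.isVertexRepr hK hL k ω).vertices v (by simpa using hv), hv⟩, And.right⟩
    rw [hsub, Finset.card_filter, Nat.cast_sum]
    exact Finset.sum_congr rfl fun v _ => by by_cases hv : R.α k ω v = 0 <;> simp [hv]
  rw [h]
  refine Finset.measurable_fun_sum _ fun v _ => ?_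
  exact Measurable.ite (R.measurable_α k v (measurableSet_singleton 0)) measurable_const
    measurable_const

theorem measurable_Φ (hK : Convex ℝ K) (hL : 0 < L) (hfin : (K.extremePoints ℝ).Finite)
    (hf : ContinuousOn f K) (R : AwayRun K f L ε Ω) (ν : ℝ) (k : ℕ) : Measurable (R.Φ ν k) :=
  ((((measurable_comp_of_continuousOn hf (R.measurable_X k)
    fun ω => (R.isVertexRepr hK hL k ω).mem hK).sub_const _).const_mul ν).add
      ((R.measurable_card_U hK hL hfin k).const_mul _)).exp

theorem measurableSet_goodEvent (hf' : ContinuousOn (gradient f) K) (R : AwayRun K f L ε Ω)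
    (hXK : ∀ k ω, R.X k ω ∈ K) (εg : ℝ) (k : ℕ) : MeasurableSet (R.goodEvent εg k) :=
  measurableSet_le ((R.measurable_G k).sub
    (measurable_comp_of_continuousOn hf' (R.measurable_X k) (hXK k))).norm
    (((R.measurable_G k).inner ((R.measurable_V k).sub (R.measurable_S k))).const_mul εg)

end AwayRun

/-- A probability threshold that turns a one-step contraction on good events into a contraction in
conditional mean. -/
theorem exists_prob_threshold {κ B : ℝ} (hκ : 0 < κ) (hB : 1 < B) :
    ∃ p ∈ Set.Ioo (0 : ℝ) 1, B - (B - Real.exp (-κ)) * p ≤ Real.exp (-(κ / 2)) := by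
  have h1 : Real.exp (-κ) < Real.exp (-(κ / 2)) := Real.exp_lt_exp.2 (by linarith)
  have h2 : Real.exp (-(κ / 2)) < 1 := Real.exp_lt_one_iff.2 (by linarith)
  have h3 : 0 < B - Real.exp (-κ) := by linarith
  -- This `p` gives equality; half of the exponent `κ` is sacrificed to keep `p < 1`.
  refine ⟨(B - Real.exp (-(κ / 2))) / (B - Real.exp (-κ)),
    ⟨div_pos (by linarith) h3, (div_lt_one h3).2 (by linarith)⟩, ?_⟩
  rw [mul_div_cancel₀ _ h3.ne']
  linarith

end Processes

end FrankWolfe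

/-! ### Choice of constants and conclusion. -/

theorem mainTheorem2 {d m : ℕ} (A : Matrix (Fin m) (Fin d) ℝ) (b : Fin m → ℝ)
    (hbdd : Bornology.IsBounded (FrankWolfe.feasible A b))
    (f : EuclideanSpace ℝ (Fin d) → ℝ)
    (hdiff : ∀ x ∈ FrankWolfe.feasible A b, DifferentiableAt ℝ f x)
    (L : ℝ) (hL : 0 < L)
    (hLip : ∀ x ∈ FrankWolfe.feasible A b, ∀ y ∈ FrankWolfe.feasible A b,
      ‖gradient f x - gradient f y‖ ≤ L * ‖x - y‖)
    (μ : ℝ) (hμ : 0 < μ)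
    (hconv : ∀ x ∈ FrankWolfe.feasible A b, ∀ y ∈ FrankWolfe.feasible A b,
      f x + inner ℝ (gradient f x) (y - x) + μ / 2 * ‖x - y‖ ^ 2 ≤ f y)
    (ε : ℝ) (hε : 0 < ε)
    (εg : ℝ) (hεg_pos : 0 < εg)
    (hεg_lt : 4 * Metric.diam (FrankWolfe.feasible A b) * εg < 1) :
    ∃ pg ∈ Set.Ioo (0 : ℝ) 1, ∃ ν ∈ Set.Ioo (0 : ℝ) 1,
    ∃ δS ∈ Set.Ioo (0 : ℝ) 1, ∃ δA ∈ Set.Ioo (0 : ℝ) 1,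
      (∀ (Ω : Type*) [MeasurableSpace Ω] (P : Measure Ω) [IsProbabilityMeasure P]
        (R : FrankWolfe.StandardRun (FrankWolfe.feasible A b) f L ε Ω) (k : ℕ),
        R.GoodWithProb P pg k →
          Integrable (fun ω => R.Φ (k + 1) ω / R.Φ k ω) P ∧
          ∀ᵐ ω ∂P, {ω | (k : ℕ∞) < R.T ω}.indicator
            (P[fun ω => R.Φ (k + 1) ω / R.Φ k ω | R.filtration k]) ω ≤ Real.exp (-δS)) ∧
      (∀ (Ω : Type*) [MeasurableSpace Ω] (P : Measure Ω) [IsProbabilityMeasure P]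
        (R : FrankWolfe.AwayRun (FrankWolfe.feasible A b) f L ε Ω) (k : ℕ),
        R.GoodWithProb P εg pg k →
          Integrable (fun ω => R.Φ ν (k + 1) ω / R.Φ ν k ω) P ∧
          ∀ᵐ ω ∂P, {ω | (k : ℕ∞) < R.T ω}.indicator
            (P[fun ω => R.Φ ν (k + 1) ω / R.Φ ν k ω | R.filtration k]) ω
              ≤ Real.exp (-δA)) := by
  have hK := FrankWolfe.convex_feasible A b
  have hfin := FrankWolfe.finite_extremePoints_feasible A b
  have hcpt := Metric.isCompact_of_isClosed_isBounded (FrankWolfe.isClosed_feasible A b) hbdd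
  set K := FrankWolfe.feasible A b
  have hf : ContinuousOn f K := fun x hx => (hdiff x hx).continuousAt.continuousWithinAt
  have hf' : ContinuousOn (gradient f) K :=
    (LipschitzOnWith.of_dist_le_mul (K := ⟨L, hL.le⟩) fun x hx y hy => by
      rw [dist_eq_norm, dist_eq_norm]
      exact hLip x hx y hy).continuousOn
  have hDnn : 0 ≤ Metric.diam K := Metric.diam_nonneg
  obtain ⟨M, hM0, hM⟩ : ∃ M : ℝ, 0 ≤ M ∧ ∀ x ∈ K, ∀ y ∈ K, f y - f x ≤ M := by
    obtain ⟨C, hC⟩ := hcpt.exists_bound_of_continuousOn hf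
    refine ⟨2 * |C|, by positivity, fun x hx y hy => ?_⟩
    have h1 := abs_le.1 ((hC x hx).trans (le_abs_self C))
    have h2 := abs_le.1 ((hC y hy).trans (le_abs_self C))
    linarith
  -- Here `y` is a minimizer of `f` on `K`, and the first-order convexity inequality bounds the gap
  -- below by `f x - f*`.
  have hgap : ∀ x ∈ K, ε < f x - FrankWolfe.optVal K f →
      ∃ y ∈ K, ε ≤ inner ℝ (gradient f x) (x - y) := by
    intro x hx hxε
    obtain ⟨y, hy, hy'⟩ := hcpt.exists_sInf_image_eq ⟨x, hx⟩ hf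
    refine ⟨y, hy, ?_⟩
    have h1 := hconv x hx y hy
    have h2 : 0 ≤ μ / 2 * ‖x - y‖ ^ 2 := by positivity
    rw [FrankWolfe.optVal, hy'] at hxε
    rw [inner_sub_right] at h1 ⊢
    linarith
  set c := (1 / 2 - 2 * Metric.diam K * εg) *
    min ((2 * ε / 5) ^ 2 / (L * (Metric.diam K ^ 2 + 1))) (2 * ε / 5)
  have hc : 0 < c := mul_pos (by linarith) (lt_min (by positivity) (by positivity))
  -- This balances the cases: a drop of `c` with one new vertex gives `-ν * c + (1 - ν) = -(1 - ν)`,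
  -- the same as dropping a vertex with no increase of `f`.
  obtain ⟨ν, hν, hνc⟩ : ∃ ν ∈ Set.Ioo (0 : ℝ) 1, 1 - ν = ν * c / 2 := by
    refine ⟨1 / (1 + c / 2), ⟨by positivity, (div_lt_one (by positivity)).2 (by linarith)⟩, ?_⟩
    field_simp
    ring
  set κS := min 1 (ε / (2 * L * (Metric.diam K ^ 2 + 1))) * (ε / 2)
  have hκS : 0 < κS := mul_pos (lt_min one_pos (by positivity)) (by positivity)
  obtain ⟨κ, hκ0, hκ1, hκν, hκκS⟩ : ∃ κ : ℝ, 0 < κ ∧ κ < 1 ∧ κ ≤ 1 - ν ∧ κ ≤ κS :=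
    ⟨min (1 - ν) κS, lt_min (sub_pos.2 hν.2) hκS, (min_le_left _ _).trans_lt (by linarith [hν.1]),
      min_le_left _ _, min_le_right _ _⟩
  -- In the exponent, `M` covers the change of `f` and `1` covers `(1 - ν)` times at most one new
  -- vertex; one bound thus serves both algorithms.
  have hB : 1 < Real.exp (M + 1) := Real.one_lt_exp_iff.2 (by linarith)
  obtain ⟨p, hp, hpB⟩ := FrankWolfe.exists_prob_threshold hκ0 hB
  have haB : Real.exp (-κ) ≤ Real.exp (M + 1) := Real.exp_le_exp.2 (by linarith)
  have hδ : κ / 2 ∈ Set.Ioo (0 : ℝ) 1 := ⟨by linarith, by linarith⟩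
  refine ⟨p, hp, ν, hν, κ / 2, hδ, κ / 2, hδ, ?_, ?_⟩
  · intro Ω _ P _ R k hgood
    have hXK := R.X_mem hK hL hε
    refine FrankWolfe.condExp_le_of_prob_le (R.filtration.le k) P
      ((R.measurable_Φ hf hXK (k + 1)).div (R.measurable_Φ hf hXK k))
      (fun ω => div_nonneg (Real.exp_pos _).le (Real.exp_pos _).le)
      (R.measurableSet_goodEvent hf' hXK k)
      (FrankWolfe.measurableSet_lt_terminalTime hf hXK fun j hj => R.measurable_X_filtration hj)
      haB (fun ω => ?_) (fun ω hω hωT => ?_) hgood hpB (Real.exp_pos _).le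
    · rw [Pi.div_apply, R.Φ_ratio, Real.exp_le_exp]
      linarith [hM _ (hXK k ω) _ (hXK (k + 1) ω)]
    · obtain ⟨y, hy, hxy⟩ := hgap _ (hXK k ω) (FrankWolfe.lt_terminalTime_iff.1 hωT k le_rfl)
      have : _ ≤ f (R.X k ω) - κS := FrankWolfe.standardStep_progress hK hbdd hdiff hL hLip
        hε (hXK k ω) (R.lp k ω hωT) hy hxy hω
      rw [Pi.div_apply, R.Φ_ratio, Real.exp_le_exp, R.step k ω hωT]
      linarith
  · intro Ω _ P _ R k hgood
    have hXK : ∀ k ω, R.X k ω ∈ K := fun k ω => (R.isVertexRepr hK hL k ω).mem hK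
    refine FrankWolfe.condExp_le_of_prob_le (R.filtration.le k) P
      ((R.measurable_Φ hK hL hfin hf ν (k + 1)).div (R.measurable_Φ hK hL hfin hf ν k))
      (fun ω => div_nonneg (Real.exp_pos _).le (Real.exp_pos _).le)
      (R.measurableSet_goodEvent hf' hXK εg k)
      (FrankWolfe.measurableSet_lt_terminalTime hf hXK fun j hj => R.measurable_X_filtration hj)
      haB (fun ω => ?_) (fun ω hω hωT => ?_) hgood hpB (Real.exp_pos _).le
    · rw [Pi.div_apply, R.Φ_ratio, Real.exp_le_exp]
      have h1 := mul_le_mul_of_nonneg_left (hM _ (hXK k ω) _ (hXK (k + 1) ω)) hν.1.le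
      have h2 := mul_le_mul_of_nonneg_right hν.2.le hM0
      have h3 : ((R.U (k + 1) ω).card : ℝ) ≤ (R.U k ω).card + 1 := by
        exact_mod_cast R.card_U_succ_le hK hL k ω
      have h4 := mul_le_mul_of_nonneg_left (sub_le_iff_le_add'.2 h3) (sub_pos.2 hν.2).le
      linarith [hν.1]
    · obtain ⟨y, hy, hxy⟩ := hgap _ (hXK k ω) (FrankWolfe.lt_terminalTime_iff.1 hωT k le_rfl)
      have key := (R.isVertexRepr hK hL k ω).next_progress hK hbdd hdiff hL hLip hε hεg_pos hεg_lt
        (R.lp k ω hωT) (R.away k ω hωT).1 (R.away k ω hωT).2 hy hxy hω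
      rw [← R.X_succ hωT, ← R.α_succ hωT] at key
      rw [Pi.div_apply, R.Φ_ratio, Real.exp_le_exp]
      rcases key with ⟨h1, h2⟩ | ⟨h1, h2⟩
      · have h3 : ((R.U (k + 1) ω).card : ℝ) ≤ (R.U k ω).card + 1 := by exact_mod_cast h2
        have h4 := mul_le_mul_of_nonneg_left (sub_le_iff_le_add'.2 h3) (sub_pos.2 hν.2).le
        have h5 : _ ≤ ν * (f (R.X k ω) - c) := mul_le_mul_of_nonneg_left h1 hν.1.le
        linarith
      · have h3 : ((R.U (k + 1) ω).card : ℝ) + 1 ≤ (R.U k ω).card := by exact_mod_cast h2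
        have h4 := mul_le_mul_of_nonneg_left h3 (sub_pos.2 hν.2).le
        have h5 := mul_le_mul_of_nonneg_left h1 hν.1.le
        linarith
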